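/- \textbf{Setting.} Processes are taken in the stable-failures model of CSP over a set $\Sigma$ of events ($\checkmark\notin\Sigma$ signals termination): a process $P$ is given by its traces and its stable failures $(s,X)$, subject to the usual healthiness conditions. $Q \sqsubseteq_F P$ means $\mathrm{traces}(P)\subseteq \mathrm{traces}(Q)$ and $\mathrm{failures}(P)\subseteq\mathrm{failures}(Q)$; recursion $X=F(X)$ denotes $\bigsqcap_{m} F^m(\mathrm{div})$. A network $V=\langle (A_1,P_1),\dots,(A_n,P_n)\rangle$, $n\ge 1$, consists of alphabets $A_i\subseteq\Sigma$ and processes $P_i$ all of whose events lie in $A_i$. It is \emph{live} if every $P_i$ is deadlock free (never stably refuses $\Sigma\cup\{\checkmark\}$ after a trace in $\Sigma^*$), no $P_i$ terminates, and every event belongs to at most two of the $A_i$. Let $\mathit{Voc}=\bigcup_{i\ne j}(A_i\cap A_j)$ and $\mathrm{Abs}(i)=P_i\setminus(\Sigma-\mathit{Voc})$ (hiding). A state of $V$ is a pair $(s,(R_1,\dots,R_n))$ with $s\in\Sigma^*$ and $(s\restriction A_i,R_i)\in\mathrm{failures}(P_i)$ for all $i$; it is deadlocked if $\bigcup_i (A_i\cap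 R_i)=\bigcup_i A_i$; $V$ is \emph{deadlock free} if it has no deadlocked state. \textbf{Descriptor.} Let $\mathcal C\subseteq\{1,\dots,n\}^2$ and, for $(i,j)\in\mathcal C$, let $link(i,j)\in\{1,\dots,n\}$ be a component, with $link$ injective on $\mathcal C$; let $D_{ij}$ be a nonempty set of data, let $send_{ij}.d$ and $receive_{ij}.d$ ($d\in D_{ij}$) be events, forming the sets $send(i,j)$ and $receive(i,j)$, and let $on(i,j)$, $off(i,j)$, $timeout(i,j)$ be events. The participants are the indices occurring in a pair of $\mathcal C$; the transport entities are the $link(i,j)$, $(i,j)\in\mathcal C$. For each participant $i$ let $S(i)$ be a finite sequence of components. \textbf{Structural compliance.} (a) Participants and transport entities partition $\{1,\dots,n\}$. (b) The five sets of all send, receive, on, off and timeout events (over $\mathcal C$) are pairwise disjoint. (c) For each participant $i$, $$A_i\cap \mathit{Voc}=\bigcup_{(i,j)\in\mathcal C}\bigl(send(i,j)\cup\{on(i,j),off(i,j)\}\bigr)\cup\bigcup_{(j,i)\in\mathcal C}\bigl(receive(j,i)\cup\{timeout(j,i)\}\bigr).$$ (d) For each $(i,j)\in\mathcal C$, $A_{link(i,j)}\cap\mathit{Voc}=send(i,j)\cup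 receive(i,j)\cup\{on(i,j),off(i,j),timeout(i,j)\}$. \textbf{Behavioural compliance.} (e) For each $(i,j)\in\mathcal C$, $\mathit{TransportSpec}\sqsubseteq_F\mathrm{Abs}(link(i,j))$, where $\mathit{TransportSpec}=\mathit{Off}$ is given by ($\Box$ is external choice) $$\mathit{Off}=on(i,j)\to \mathit{On}\ \Box\ timeout(i,j)\to \mathit{Off},\qquad \mathit{On}=off(i,j)\to \mathit{Off}\ \Box\ send_{ij}?d\to \mathit{OnF}(d),$$ $$\mathit{OnF}(d)=off(i,j)\to \mathit{Off}\ \Box\ send_{ij}?d'\to \mathit{OnF}(d')\ \Box\ receive_{ij}.d\to \mathit{On}.$$ (f) For each participant $i$, $\mathit{ParticipantSpec}(i)\sqsubseteq_F\mathrm{Abs}(i)$, where $$\mathit{ParticipantSpec}(i)=\mathit{OnDetect};\bigl(\mathit{SendReceive}\,\triangle\,(\mathit{SKIP}\sqcap \mathit{STOP})\bigr);\mathit{OffDetect};\mathit{ParticipantSpec}(i),$$ $\mathit{SendReceive}=\mathit{Send};\mathit{Receive};\mathit{SendReceive}$, and $\triangle$ is interrupt. Here $\mathit{OnDetect}$ (resp.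 $\mathit{OffDetect}$) performs $on(i,j)$ (resp. $off(i,j)$), and $\mathit{Send}$ performs $send_{ij}.d$ for some internally chosen $d$, once for each entry $j$ of $S(i)$ with $(i,j)\in\mathcal C$, in the order of $S(i)$, and then terminates; $\mathit{Receive}$ offers the external choice of all $receive_{ji}.d$ and $timeout(j,i)$ for each entry $j$ of $S(i)$ with $(j,i)\in\mathcal C$, in the order of $S(i)$, and then terminates. (g) For each participant $i$, no component occurs twice in $S(i)$. \textbf{Theorem (async dynamic).} Every live network $V$ that is structurally and behaviourally compliant, in the above sense, with such a descriptor and such sequences $S(i)$ is deadlock free. -/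

import Mathlib

universe u v

namespace CSP

/-- Observable events together with the termination signal: `some a` is the event `a`,
`none` is the termination signal (tick). -/
abbrev Obs (E : Type u) : Type u := Option E

/-- A point of the stable-failures semantics: a set of finite traces and a set of stable failures
(trace, refusal set). -/
@[ext] structure Sem (E : Type u) where
  traces : Set (List (Obs E))
  failures : Set (List (Obs E) × Set (Obs E))

namespace Sem

variable {E : Type u}

/-- The healthiness conditions of the stable-failures model. -/
structure Healthy (P : Sem E) : Prop where
  nil_mem : [] ∈ P.traces
  prefix_closed : ∀ s t, s ++ t ∈ P.traces → s ∈ P.traces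
  tick_last : ∀ s t, s ++ none :: t ∈ P.traces → t = []
  trace_of_failure : ∀ s X, (s, X) ∈ P.failures → s ∈ P.traces
  subset_closed : ∀ s X Y, (s, X) ∈ P.failures → Y ⊆ X → (s, Y) ∈ P.failures
  refuse_impossible : ∀ s X Y, (s, X) ∈ P.failures →
    (∀ a ∈ Y, s ++ [a] ∉ P.traces) → (s, X ∪ Y) ∈ P.failures
  before_tick : ∀ s, s ++ [none] ∈ P.traces → (s, {x | x ≠ none}) ∈ P.failures
  after_tick : ∀ s X, s ++ [none] ∈ P.traces → (s ++ [none], X) ∈ P.failures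

/-- `Spec [F= Impl`. -/
def Refines (Spec Impl : Sem E) : Prop :=
  Impl.traces ⊆ Spec.traces ∧ Impl.failures ⊆ Spec.failures

/-- No reachable stable refusal of everything (successful termination is not deadlock). -/
def DeadlockFree (P : Sem E) : Prop :=
  ∀ s : List E, (s.map some, Set.univ) ∉ P.failures

def NonTerminating (P : Sem E) : Prop :=
  ∀ s, s ++ [none] ∉ P.traces

/-! ### Operators -/

def STOP : Sem E where
  traces := {[]}
  failures := {f | f.1 = []}

def SKIP : Sem E where
  traces := {[], [none]}
  failures := {f | f.1 = [] ∧ none ∉ f.2} ∪ {f | f.1 = [none]}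

/-- The diverging process. -/
def DIV : Sem E where
  traces := {[]}
  failures := ∅

/-- `a -> P`. -/
def pre (a : E) (P : Sem E) : Sem E where
  traces := {[]} ∪ {t | ∃ s ∈ P.traces, t = some a :: s}
  failures := {f | f.1 = [] ∧ some a ∉ f.2} ∪
    {f | ∃ s, (s, f.2) ∈ P.failures ∧ f.1 = some a :: s}

/-- `P ; Q`. -/
def seq (P Q : Sem E) : Sem E where
  traces := {s | s ∈ P.traces ∧ none ∉ s} ∪
    {u | ∃ s t, s ++ [none] ∈ P.traces ∧ t ∈ Q.traces ∧ u = s ++ t}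
  failures := {f | none ∉ f.1 ∧ (f.1, f.2 ∪ {none}) ∈ P.failures} ∪
    {f | ∃ s t, s ++ [none] ∈ P.traces ∧ (t, f.2) ∈ Q.failures ∧ f.1 = s ++ t}

/-- External choice `[] x @ P x`; over an empty index it is `STOP`. -/
def extChoiceOver {ι : Type v} (P : ι → Sem E) : Sem E where
  traces := {[]} ∪ {t | ∃ x, t ∈ (P x).traces}
  failures := {f | f.1 = [] ∧ ∀ x, f ∈ (P x).failures} ∪
    {f | f.1 ≠ [] ∧ ∃ x, f ∈ (P x).failures} ∪
    {f | f.1 = [] ∧ none ∉ f.2 ∧ ∃ x, [none] ∈ (P x).traces}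

/-- `P [] Q`. -/
def extChoice (P Q : Sem E) : Sem E :=
  extChoiceOver (fun b : Bool => cond b P Q)

/-- Internal choice `|~| x @ P x`, used over nonempty index types only. -/
def intChoiceOver {ι : Type v} (P : ι → Sem E) : Sem E where
  traces := {t | ∃ x, t ∈ (P x).traces}
  failures := {f | ∃ x, f ∈ (P x).failures}

/-- `P |~| Q`. -/
def intChoice (P Q : Sem E) : Sem E :=
  intChoiceOver (fun b : Bool => cond b P Q)

/-- `P /\ Q`: at any point before its termination, `P` may be interrupted by an initial
observable action of `Q`. -/
def interrupt (P Q : Sem E) : Sem E where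
  traces := P.traces ∪
    {u | ∃ s t, s ∈ P.traces ∧ none ∉ s ∧ t ∈ Q.traces ∧ u = s ++ t}
  failures :=
    {f | f ∈ P.failures ∧ none ∉ f.1 ∧ ([], f.2) ∈ Q.failures} ∪
    {f | f.1 ++ [none] ∈ P.traces ∧ none ∉ f.2} ∪
    {f | ∃ s, s ++ [none] ∈ P.traces ∧ f.1 = s ++ [none]} ∪
    {f | ∃ s t, s ∈ P.traces ∧ none ∉ s ∧ (t, f.2) ∈ Q.failures ∧ t ≠ [] ∧ f.1 = s ++ t} ∪
    {f | f.1 ∈ P.traces ∧ none ∉ f.1 ∧ [none] ∈ Q.traces ∧ none ∉ f.2}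

open Classical in
/-- The trace `s` with the events of `H` removed. -/
noncomputable def hideTrace (H : Set E) (s : List (Obs E)) : List (Obs E) :=
  s.filter (fun x => decide (x ∉ some '' H))

/-- `P \ H`. -/
def hide (P : Sem E) (H : Set E) : Sem E where
  traces := {u | ∃ s ∈ P.traces, u = hideTrace H s}
  failures := {f | ∃ t, (t, f.2 ∪ some '' H) ∈ P.failures ∧ f.1 = hideTrace H t}

/-- The recursive process `X = F(X)`, i.e. the internal choice of all `F^n(div)`. -/
def mu (F : Sem E → Sem E) : Sem E :=
  intChoiceOver (fun n : ℕ => F^[n] DIV)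

/-- A family of mutually recursive processes `X x = F X x`. -/
def muFamily {ι : Type v} (F : (ι → Sem E) → ι → Sem E) (x : ι) : Sem E :=
  intChoiceOver (fun n : ℕ => F^[n] (fun _ => DIV) x)

end Sem

/-! ### Networks -/

/-- A network of `n` components `(A i, P i)`: `P i` is a process whose events all lie in the
alphabet `A i`. -/
structure Network (E : Type u) (n : ℕ) where
  A : Fin n → Set E
  P : Fin n → Sem E
  healthy : ∀ i, (P i).Healthy
  events_mem : ∀ i, ∀ t ∈ (P i).traces, ∀ a : E, some a ∈ t → a ∈ A i

namespace Network

variable {E : Type u} {n : ℕ} (V : Network E n)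

/-- The vocabulary: events shared by two distinct components. -/
def Voc : Set E := {a | ∃ i j, i ≠ j ∧ a ∈ V.A i ∧ a ∈ V.A j}

/-- The alphabet of the whole network. -/
def alphabet : Set E := ⋃ i, V.A i

/-- The abstract behaviour of a component: all events outside the vocabulary are hidden. -/
def Abs (i : Fin n) : Sem E := (V.P i).hide (V.Vocᶜ)

/-- Busy, non-terminating and triple disjoint. -/
structure Live : Prop where
  busy : ∀ i, (V.P i).DeadlockFree
  nonTerminating : ∀ i, (V.P i).NonTerminating
  tripleDisjoint : ∀ i j k, i ≠ j → j ≠ k → i ≠ k → V.A i ∩ V.A j ∩ V.A k = ∅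

open Classical in
/-- The restriction of a network trace to the alphabet of component `i`. -/
noncomputable def proj (i : Fin n) (s : List E) : List (Obs E) :=
  (s.filter (fun a => decide (a ∈ V.A i))).map some

/-- `(s, R)` is a state: after its part of the network trace `s`, each component `i` can stably
refuse `R i`.  The refusal sets are not required to be maximal; see
`deadlockFree_iff_maximal`. -/
def IsState (s : List E) (R : Fin n → Set (Obs E)) : Prop :=
  ∀ i, (V.proj i s, R i) ∈ (V.P i).failures

/-- States whose refusal sets are moreover maximal. -/
def IsMaximalState (s : List E) (R : Fin n → Set (Obs E)) : Prop :=
  ∀ i, Maximal (fun X => (V.proj i s, X) ∈ (V.P i).failures) (R i)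

def refusals (R : Fin n → Set (Obs E)) : Set E :=
  ⋃ i, {a | a ∈ V.A i ∧ some a ∈ R i}

/-- Every event of the network is refused. -/
def Deadlocked (R : Fin n → Set (Obs E)) : Prop :=
  V.refusals R = V.alphabet

def DeadlockFree : Prop :=
  ∀ s R, V.IsState s R → ¬ V.Deadlocked R

/-- Over a finite set of events one may equivalently look at maximal refusal sets only. -/
theorem deadlockFree_iff_maximal [Finite E] :
    V.DeadlockFree ↔ ∀ s R, V.IsMaximalState s R → ¬ V.Deadlocked R := by
  constructor
  · intro h s R hR
    exact h s R (fun i => (hR i).prop)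
  · intro h s R hR hD
    have hex : ∀ i, ∃ X, R i ⊆ X ∧
        Maximal (fun X => (V.proj i s, X) ∈ (V.P i).failures) X := fun i =>
      Set.Finite.exists_le_maximal
        (s := {X | (V.proj i s, X) ∈ (V.P i).failures}) (Set.toFinite _) (hR i)
    choose R' hsub hmax using hex
    refine h s R' hmax (Set.Subset.antisymm ?_ ?_)
    · exact Set.iUnion_mono (fun i a ha => ha.1)
    · rw [← hD]
      exact Set.iUnion_mono (fun i a ha => ⟨ha.1, hsub i ha.2⟩)

end Network

/-! ### The async-dynamic pattern -/

/-- An async-dynamic descriptor.  `send i j` and `receive i j` are channels carrying the data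
values `Data i j`, so the sets of events used to pass data from `i` to `j` are their ranges.
Only values at pairs in `C` matter.  Each transport entity links a unique pair. -/
structure AsyncDynamic (E : Type u) (n : ℕ) where
  C : Set (Fin n × Fin n)
  link : Fin n → Fin n → Fin n
  Data : Fin n → Fin n → Type v
  send : (i j : Fin n) → Data i j → E
  receive : (i j : Fin n) → Data i j → E
  turnOn : Fin n → Fin n → E
  turnOff : Fin n → Fin n → E
  timeout : Fin n → Fin n → E
  data_nonempty : ∀ i j, (i, j) ∈ C → Nonempty (Data i j)
  link_unique : ∀ i j i' j', (i, j) ∈ C → (i', j') ∈ C → link i j = link i' j' →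
    i = i' ∧ j = j'

/-- The five kinds of events used by the pattern. -/
inductive Activity
  | sending | receiving | turningOn | turningOff | timingOut

/-- States of the transport specification. -/
inductive TState (D : Type v)
  | on | onF (d : D) | off

namespace AsyncDynamic

variable {E : Type u} {n : ℕ} (M : AsyncDynamic.{u, v} E n)

def participants : Set (Fin n) := {i | ∃ j, (i, j) ∈ M.C ∨ (j, i) ∈ M.C}

def transportEntities : Set (Fin n) := {k | ∃ i j, (i, j) ∈ M.C ∧ k = M.link i j}

/-- All the events used for a given activity. -/
def events : Activity → Set E
  | .sending => {a | ∃ i j, (i, j) ∈ M.C ∧ a ∈ Set.range (M.send i j)}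
  | .receiving => {a | ∃ i j, (i, j) ∈ M.C ∧ a ∈ Set.range (M.receive i j)}
  | .turningOn => {a | ∃ i j, (i, j) ∈ M.C ∧ a = M.turnOn i j}
  | .turningOff => {a | ∃ i j, (i, j) ∈ M.C ∧ a = M.turnOff i j}
  | .timingOut => {a | ∃ i j, (i, j) ∈ M.C ∧ a = M.timeout i j}

/-- Structural compliance of a network and a descriptor.  The timeout of a link is an event of
the link and of its receiver, which may time out instead of receiving data. -/
structure StructurallyCompliant (V : Network E n) : Prop where
  partition_disjoint : M.participants ∩ M.transportEntities = ∅
  partition_cover : M.participants ∪ M.transportEntities = Set.univ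
  mutually_disjoint_events : ∀ x y, x ≠ y → M.events x ∩ M.events y = ∅
  controlled_alpha_participant : ∀ i ∈ M.participants, V.A i ∩ V.Voc =
    {a | ∃ j, (i, j) ∈ M.C ∧ a ∈ Set.range (M.send i j)} ∪
    {a | ∃ j, (j, i) ∈ M.C ∧ a ∈ Set.range (M.receive j i)} ∪
    {a | ∃ j, (i, j) ∈ M.C ∧ (a = M.turnOn i j ∨ a = M.turnOff i j)} ∪
    {a | ∃ j, (j, i) ∈ M.C ∧ a = M.timeout j i}
  controlled_alpha_transport_entity : ∀ i j, (i, j) ∈ M.C →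
    V.A (M.link i j) ∩ V.Voc =
      Set.range (M.send i j) ∪ Set.range (M.receive i j) ∪
      {M.turnOn i j, M.turnOff i j} ∪ {M.timeout i j}

open Sem

/-- The specification of the transport entity `link i j`:
```
On     = off -> Off [] send?data -> OnF(data)
OnF(d) = off -> Off [] send?data -> OnF(data) [] receive!d -> On
Off    = on -> On [] timeout -> Off
```
started in `Off`. -/
def TransportSpec (i j : Fin n) : Sem E :=
  muFamily (ι := TState (M.Data i j)) (fun X st =>
    match st with
    | .on => extChoice (pre (M.turnOff i j) (X .off))
        (extChoiceOver fun d => pre (M.send i j d) (X (.onF d)))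
    | .onF d => extChoice (pre (M.turnOff i j) (X .off))
        (extChoice (extChoiceOver fun d' => pre (M.send i j d') (X (.onF d')))
          (pre (M.receive i j d) (X .on)))
    | .off => extChoice (pre (M.turnOn i j) (X .on)) (pre (M.timeout i j) (X .off)))
    .off

open Classical in
/-- The members of the sequence `s` to which `i` has a link, in the order of `s`. -/
noncomputable def outPeers (i : Fin n) (s : List (Fin n)) : List (Fin n) :=
  s.filter (fun j => decide ((i, j) ∈ M.C))

open Classical in
/-- The members of the sequence `s` that have a link to `i`, in the order of `s`. -/
noncomputable def inPeers (i : Fin n) (s : List (Fin n)) : List (Fin n) :=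
  s.filter (fun j => decide ((j, i) ∈ M.C))

/-- Perform the processes `f j`, for `j` in the list, one after the other, then terminate. -/
def inOrder (f : Fin n → Sem E) : List (Fin n) → Sem E
  | [] => SKIP
  | j :: s => seq (f j) (inOrder f s)

/-- Signal `on` to every transport entity that has `i` as its sender. -/
noncomputable def OnDetect (i : Fin n) (s : List (Fin n)) : Sem E :=
  inOrder (fun j => pre (M.turnOn i j) SKIP) (M.outPeers i s)

/-- Signal `off` to every transport entity that has `i` as its sender. -/
noncomputable def OffDetect (i : Fin n) (s : List (Fin n)) : Sem E :=
  inOrder (fun j => pre (M.turnOff i j) SKIP) (M.outPeers i s)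

/-- Send one message, with data of the participant's own choosing, to every transport entity that
has `i` as its sender. -/
noncomputable def Send (i : Fin n) (s : List (Fin n)) : Sem E :=
  inOrder (fun j => intChoiceOver fun d => pre (M.send i j d) SKIP) (M.outPeers i s)

/-- Accept data or a timeout from every transport entity that has `i` as its receiver. -/
noncomputable def Receive (i : Fin n) (s : List (Fin n)) : Sem E :=
  inOrder (fun j => extChoice (extChoiceOver fun d => pre (M.receive j i d) SKIP)
    (pre (M.timeout j i) SKIP)) (M.inPeers i s)

/-- `SendReceive = Send ; Receive ; SendReceive`. -/
noncomputable def SendReceive (i : Fin n) (s : List (Fin n)) : Sem E :=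
  mu fun X => seq (M.Send i s) (seq (M.Receive i s) X)

/-- The specification of participant `i` with interaction sequence `s`:
`X = OnDetect ; (SendReceive /\ (SKIP |~| STOP)) ; OffDetect ; X`. -/
noncomputable def ParticipantSpec (i : Fin n) (s : List (Fin n)) : Sem E :=
  mu fun X => seq (M.OnDetect i s)
    (seq (interrupt (M.SendReceive i s) (intChoice SKIP STOP))
      (seq (M.OffDetect i s) X))

/-- Behavioural compliance, with `S i` the sequence in which participant `i` interacts with its
peers. -/
structure BehaviourallyCompliant (V : Network E n) (S : Fin n → List (Fin n)) : Prop where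
  transport : ∀ i j, (i, j) ∈ M.C → (M.TransportSpec i j).Refines (V.Abs (M.link i j))
  participant : ∀ i ∈ M.participants, (M.ParticipantSpec i (S i)).Refines (V.Abs i)
  no_repeats : ∀ i ∈ M.participants, (S i).Nodup

end AsyncDynamic

end CSP

/-! Two devices drive the argument. Every process is observed only through what it does before
terminating, so that the operators of CSP become computation rules for the refusals that include
termination. Positions of last occurrences in the network trace serve as times.

In a deadlocked state no event of the pattern can happen. A participant that waits to switch a link
or to send on it is never blocked, because a link that is off accepts `on` and a link that is on
accepts `off` and every `send`. Hence every participant `i` waits for data from some peer `j`, whose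
link is on and holds no data. This peer is blocked in the same way, waiting for data from some `k`,
and since it last received from `k` it has sent to `i`. As the link holds no data, `i` has received
from `j` after that. So the time at which the awaited data was last received strictly decreases from
`i` to `j`, which is impossible because there are finitely many participants. -/

universe w

namespace CSP

section LastPos

variable {X : Type w} {α β : Set X} {s v : List X} {x : X}

open Classical in
/-- The position, counted from `1`, of the last entry of `s` that lies in `α`; it is `0` if there is
no such entry. -/
noncomputable def lastPos (α : Set X) (s : List X) : ℕ :=
  (s.rdropWhile (fun x => decide (x ∉ α))).length

@[simp]
theorem lastPos_nil : lastPos α [] = 0 := by simp [lastPos]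

theorem lastPos_le_length : lastPos α s ≤ s.length :=
  (List.rdropWhile_prefix _ _).length_le

theorem lastPos_concat_of_mem (hx : x ∈ α) : lastPos α (s ++ [x]) = s.length + 1 := by
  simp [lastPos, hx]

theorem lastPos_concat_of_notMem (hx : x ∉ α) : lastPos α (s ++ [x]) = lastPos α s := by
  simp [lastPos, hx]

theorem lastPos_append_of_notMem (hv : ∀ x ∈ v, x ∉ α) : lastPos α (s ++ v) = lastPos α s := by
  induction v using List.reverseRecOn with
  | nil => simp
  | append_singleton v x ih =>
    rw [← List.append_assoc, lastPos_concat_of_notMem (hv x (by simp)),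
      ih fun y hy => hv y (by simp [hy])]

theorem length_lt_lastPos_append (hv : ∃ x ∈ v, x ∈ α) : s.length < lastPos α (s ++ v) := by
  induction v using List.reverseRecOn with
  | nil => simp at hv
  | append_singleton v x ih =>
    rw [← List.append_assoc]
    by_cases hx : x ∈ α
    · rw [lastPos_concat_of_mem hx, List.length_append]
      omega
    · rw [lastPos_concat_of_notMem hx]
      obtain ⟨y, hy, hyα⟩ := hv
      obtain hy | rfl : y ∈ v ∨ y = x := by simpa using hy
      · exact ih ⟨y, hy, hyα⟩
      · exact absurd hyα hx

theorem lastPos_append_lt_lastPos_append (hα : ∀ x ∈ v, x ∉ α) (hβ : ∃ x ∈ v, x ∈ β) :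
    lastPos α (s ++ v) < lastPos β (s ++ v) := by
  rw [lastPos_append_of_notMem hα]
  exact lastPos_le_length.trans_lt (length_lt_lastPos_append hβ)

theorem lastPos_filter_lt_lastPos_filter_iff {p : X → Bool} (hα : ∀ x ∈ α, p x)
    (hβ : ∀ x ∈ β, p x) :
    lastPos α (s.filter p) < lastPos β (s.filter p) ↔ lastPos α s < lastPos β s := by
  induction s using List.reverseRecOn with
  | nil => simp
  | append_singleton s x ih =>
    have hle : ∀ {γ : Set X} {t : List X}, ¬ t.length + 1 < lastPos γ t := fun {γ t} =>
      (lastPos_le_length.trans t.length.le_succ).not_gt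
    have hlt : ∀ {γ : Set X} {t : List X}, lastPos γ t < t.length + 1 :=
      Nat.lt_succ_of_le lastPos_le_length
    rw [List.filter_append]
    by_cases hp : p x
    · rw [List.filter_cons_of_pos hp, List.filter_nil]
      by_cases hxα : x ∈ α <;> by_cases hxβ : x ∈ β <;>
        simp only [lastPos_concat_of_mem, lastPos_concat_of_notMem, hxα, hxβ, not_false_eq_true,
          lt_irrefl, hle, hlt, ih]
    · rw [List.filter_cons_of_neg hp, List.filter_nil, List.append_nil, ih,
        lastPos_concat_of_notMem fun h => hp (hα x h),
        lastPos_concat_of_notMem fun h => hp (hβ x h)]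

end LastPos

namespace Sem

variable {E : Type u} {ι : Type v} {P Q : Sem E} {s t : List E} {a b : E} {Y H : Set E}

/-- `s` is a trace of `P` on which `P` has not terminated. -/
def Performs (P : Sem E) (s : List E) : Prop :=
  s.map some ∈ P.traces

/-- `P` can terminate after performing `s`. -/
def Terminates (P : Sem E) (s : List E) : Prop :=
  s.map some ++ [none] ∈ P.traces

/-- After performing `s`, `P` can stably refuse all events of `Y`, and refuse to terminate as
well. -/
def Refuses (P : Sem E) (s : List E) (Y : Set E) : Prop :=
  (s.map some, insert none (some '' Y)) ∈ P.failures

/-- The part of `Healthy.tick_last` that makes `Terminates` account for all terminated traces. -/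
def TickLast (P : Sem E) : Prop :=
  ∀ s, s ++ [none] ∈ P.traces → none ∉ s

theorem NonTerminating.not_terminates (hP : P.NonTerminating) : ¬ P.Terminates s :=
  hP _

theorem tickLast_SKIP : (SKIP : Sem E).TickLast := by
  simp [TickLast, SKIP]

theorem performs_SKIP : (SKIP : Sem E).Performs s ↔ s = [] := by
  cases s <;> simp [Performs, SKIP]

theorem terminates_SKIP : (SKIP : Sem E).Terminates s ↔ s = [] := by
  simp [Terminates, SKIP]

theorem not_refuses_SKIP : ¬ (SKIP : Sem E).Refuses s Y := by
  cases s <;> simp [Refuses, SKIP]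

theorem not_refuses_DIV : ¬ (DIV : Sem E).Refuses s Y :=
  Set.notMem_empty _

theorem refuses_pre_nil : (pre a P).Refuses [] Y ↔ a ∉ Y := by
  simp [Refuses, pre]

theorem refuses_pre_cons : (pre a P).Refuses (b :: s) Y ↔ b = a ∧ P.Refuses s Y := by
  simp [Refuses, pre, and_comm]

theorem refuses_extChoiceOver_nil {P : ι → Sem E} :
    (extChoiceOver P).Refuses [] Y ↔ ∀ x, (P x).Refuses [] Y := by
  simp [Refuses, extChoiceOver]

theorem refuses_extChoiceOver_cons {P : ι → Sem E} :
    (extChoiceOver P).Refuses (a :: s) Y ↔ ∃ x, (P x).Refuses (a :: s) Y := by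
  simp [Refuses, extChoiceOver]

theorem refuses_extChoice_nil :
    (extChoice P Q).Refuses [] Y ↔ P.Refuses [] Y ∧ Q.Refuses [] Y := by
  simp [extChoice, refuses_extChoiceOver_nil, and_comm]

theorem refuses_extChoice_cons :
    (extChoice P Q).Refuses (a :: s) Y ↔ P.Refuses (a :: s) Y ∨ Q.Refuses (a :: s) Y := by
  simp [extChoice, refuses_extChoiceOver_cons, or_comm]

theorem performs_seq :
    (seq P Q).Performs s ↔
      P.Performs s ∨ ∃ s₁ s₂, s = s₁ ++ s₂ ∧ P.Terminates s₁ ∧ Q.Performs s₂ := by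
  constructor
  · rintro (⟨hs, -⟩ | ⟨u₁, u₂, hP, hQ, heq⟩)
    · exact .inl hs
    · obtain ⟨s₁, s₂, rfl, rfl, rfl⟩ := List.map_eq_append_iff.1 heq
      exact .inr ⟨s₁, s₂, rfl, hP, hQ⟩
  · rintro (hs | ⟨s₁, s₂, rfl, hP, hQ⟩)
    · exact .inl ⟨hs, by simp⟩
    · exact .inr ⟨_, _, hP, hQ, List.map_append⟩

theorem TickLast.exists_of_concat_mem_seq_traces (hP : P.TickLast) {u : List (Obs E)}
    (hu : u ++ [none] ∈ (seq P Q).traces) :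
    ∃ u₁ u₂, u = u₁ ++ u₂ ∧ u₁ ++ [none] ∈ P.traces ∧ u₂ ++ [none] ∈ Q.traces := by
  obtain ⟨-, hn⟩ | ⟨u₁, t, hP₁, hQ₂, heq⟩ := hu
  · simp at hn
  · rcases List.eq_nil_or_concat t with rfl | ⟨u₂, x, rfl⟩
    · rw [List.append_nil] at heq
      exact absurd (heq ▸ by simp) (hP u₁ hP₁)
    · obtain ⟨rfl, rfl⟩ : u = u₁ ++ u₂ ∧ none = x := by
        simpa [← List.append_assoc] using heq
      exact ⟨u₁, u₂, rfl, hP₁, by simpa using hQ₂⟩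

theorem TickLast.seq (hP : P.TickLast) (hQ : Q.TickLast) : (seq P Q).TickLast := by
  intro u hu
  obtain ⟨u₁, u₂, rfl, h₁, h₂⟩ := hP.exists_of_concat_mem_seq_traces hu
  simp [hP u₁ h₁, hQ u₂ h₂]

theorem TickLast.nonTerminating_seq (hP : P.TickLast) (hQ : Q.NonTerminating) :
    (Sem.seq P Q).NonTerminating := by
  intro u hu
  obtain ⟨_, u₂, -, -, h₂⟩ := hP.exists_of_concat_mem_seq_traces hu
  exact hQ u₂ h₂

theorem TickLast.exists_of_terminates_seq (hP : P.TickLast) (hs : (Sem.seq P Q).Terminates s) :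
    ∃ s₁ s₂, s = s₁ ++ s₂ ∧ P.Terminates s₁ ∧ Q.Terminates s₂ := by
  obtain ⟨u₁, u₂, heq, h₁, h₂⟩ := hP.exists_of_concat_mem_seq_traces hs
  obtain ⟨s₁, s₂, rfl, rfl, rfl⟩ := List.map_eq_append_iff.1 heq
  exact ⟨s₁, s₂, rfl, h₁, h₂⟩

theorem refuses_seq :
    (seq P Q).Refuses s Y ↔
      P.Refuses s Y ∨ ∃ s₁ s₂, s = s₁ ++ s₂ ∧ P.Terminates s₁ ∧ Q.Refuses s₂ Y := by
  constructor
  · rintro (⟨-, hs⟩ | ⟨u₁, u₂, hP, hQ, heq⟩)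
    · exact .inl (by simpa [Refuses] using hs)
    · obtain ⟨s₁, s₂, rfl, rfl, rfl⟩ := List.map_eq_append_iff.1 heq
      exact .inr ⟨s₁, s₂, rfl, hP, hQ⟩
  · rintro (hs | ⟨s₁, s₂, rfl, hP, hQ⟩)
    · exact .inl ⟨by simp, by simpa [Refuses] using hs⟩
    · exact .inr ⟨_, _, hP, hQ, List.map_append⟩

theorem exists_of_terminates_interrupt (hP : ¬ P.Terminates s)
    (hs : (interrupt P Q).Terminates s) :
    ∃ s₁ s₂, s = s₁ ++ s₂ ∧ P.Performs s₁ ∧ Q.Terminates s₂ := by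
  obtain hs | ⟨u, t, hu, hn, ht, heq⟩ := hs
  · exact absurd hs hP
  · rcases List.eq_nil_or_concat t with rfl | ⟨u₂, x, rfl⟩
    · rw [List.append_nil] at heq
      exact absurd (heq ▸ by simp) hn
    · obtain ⟨hmap, rfl⟩ : s.map some = u ++ u₂ ∧ none = x := by
        simpa [← List.append_assoc] using heq
      obtain ⟨s₁, s₂, rfl, rfl, rfl⟩ := List.map_eq_append_iff.1 hmap
      exact ⟨s₁, s₂, rfl, hu, by simpa [Terminates] using ht⟩

theorem refuses_or_of_refuses_interrupt (hP : ¬ P.Terminates s)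
    (hs : (interrupt P Q).Refuses s Y) :
    P.Refuses s Y ∨ ∃ s₁ s₂, s = s₁ ++ s₂ ∧ s₂ ≠ [] ∧ Q.Refuses s₂ Y := by
  obtain (((⟨h, -, -⟩ | ⟨h, -⟩) | ⟨u, -, h⟩) | ⟨u₁, u₂, -, -, hQ, hne, heq⟩) | ⟨-, -, -, h⟩ := hs
  · exact .inl h
  · exact absurd h hP
  · obtain ⟨s₁, s₂, -, -, h₂⟩ := List.map_eq_append_iff.1 h
    cases s₂ <;> simp at h₂
  · obtain ⟨s₁, s₂, rfl, rfl, rfl⟩ := List.map_eq_append_iff.1 heq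
    exact .inr ⟨s₁, s₂, rfl, by simpa using hne, hQ⟩
  · exact absurd (Set.mem_insert _ _) h

theorem terminates_intChoice_SKIP_STOP :
    (intChoice SKIP STOP : Sem E).Terminates s ↔ s = [] := by
  simp [Terminates, intChoice, intChoiceOver, SKIP, STOP]

theorem eq_nil_of_refuses_intChoice_SKIP_STOP
    (hs : (intChoice SKIP STOP : Sem E).Refuses s Y) : s = [] := by
  obtain ⟨_ | _, h⟩ := hs
  · simpa [STOP] using h
  · exact absurd h not_refuses_SKIP

open Classical in
theorem Refuses.hide (h : P.Refuses s Y) (hH : H ⊆ Y) :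
    (P.hide H).Refuses (s.filter fun a => decide (a ∉ H)) Y := by
  refine ⟨s.map some, ?_, ?_⟩
  · rwa [Set.union_eq_left.2 ((Set.image_mono hH).trans (Set.subset_insert _ _))]
  · rw [hideTrace, List.filter_map]
    exact congrArg _ (List.filter_congr fun a _ => by
      simp only [Function.comp_apply, (Option.some_injective E).mem_set_image])

/-- Scott induction. -/
theorem mu_induction {F : Sem E → Sem E} (p : Sem E → Prop)
    (admissible : ∀ P : ℕ → Sem E, (∀ n, p (P n)) → p (intChoiceOver P)) (base : p DIV)
    (step : ∀ P, p P → p (F P)) : p (mu F) :=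
  admissible _ fun n => Function.Iterate.rec p base step n

theorem muFamily_induction {F : (ι → Sem E) → ι → Sem E} (p : (ι → Sem E) → Prop)
    (admissible : ∀ P : ℕ → ι → Sem E, (∀ n, p (P n)) → p fun x => intChoiceOver fun n => P n x)
    (base : p fun _ => DIV) (step : ∀ P, p P → p (F P)) : p (muFamily F) :=
  admissible _ fun n => Function.Iterate.rec p base step n

/-- `P` performs one event of `G` and then terminates. -/
structure SingleEvent (P : Sem E) (G : Set E) : Prop where
  exists_of_tick_mem : ∀ u, u ++ [none] ∈ P.traces → ∃ a ∈ G, u = [some a]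
  mem_of_performs : ∀ s, P.Performs s → ∀ a ∈ s, a ∈ G
  eq_nil_of_refuses : ∀ s Y, P.Refuses s Y → s = []

namespace SingleEvent

variable {G : Set E}

theorem tickLast (hP : P.SingleEvent G) : P.TickLast := by
  intro u hu
  obtain ⟨a, -, rfl⟩ := hP.exists_of_tick_mem u hu
  simp

theorem exists_of_terminates (hP : P.SingleEvent G) (hs : P.Terminates s) : ∃ a ∈ G, s = [a] := by
  obtain ⟨a, ha, h⟩ := hP.exists_of_tick_mem _ hs
  exact ⟨a, ha, List.map_injective_iff.2 (Option.some_injective E) h⟩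

theorem pre_SKIP (ha : a ∈ G) : (pre a SKIP).SingleEvent G where
  exists_of_tick_mem := by
    rintro u (h | ⟨s, rfl | rfl, h⟩)
    · simp at h
    · cases u <;> simp at h
    · exact ⟨a, ha, List.append_cancel_right (bs := [none]) h⟩
  mem_of_performs := by
    rintro s (h | ⟨u, hu, h⟩) b hb
    · simp_all
    · obtain ⟨c, s, rfl, hc, rfl⟩ := List.map_eq_cons_iff.1 h
      obtain rfl := performs_SKIP.1 hu
      simp_all
  eq_nil_of_refuses := by
    rintro (_ | ⟨b, s⟩) Y h
    · rfl
    · exact absurd (refuses_pre_cons.1 h).2 not_refuses_SKIP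

theorem intChoiceOver {P : ι → Sem E} (hP : ∀ x, (P x).SingleEvent G) :
    (intChoiceOver P).SingleEvent G where
  exists_of_tick_mem := fun u ⟨x, hx⟩ => (hP x).exists_of_tick_mem u hx
  mem_of_performs := fun s ⟨x, hx⟩ => (hP x).mem_of_performs s hx
  eq_nil_of_refuses := fun s Y ⟨x, hx⟩ => (hP x).eq_nil_of_refuses s Y hx

theorem extChoiceOver {P : ι → Sem E} (hP : ∀ x, (P x).SingleEvent G) :
    (extChoiceOver P).SingleEvent G where
  exists_of_tick_mem := by
    rintro u (h | ⟨x, hx⟩)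
    · simp at h
    · exact (hP x).exists_of_tick_mem u hx
  mem_of_performs := by
    rintro s (h | ⟨x, hx⟩)
    · simp_all
    · exact (hP x).mem_of_performs s hx
  eq_nil_of_refuses := by
    rintro (_ | ⟨a, s⟩) Y h
    · rfl
    · obtain ⟨x, hx⟩ := refuses_extChoiceOver_cons.1 h
      exact (hP x).eq_nil_of_refuses _ Y hx

theorem extChoice (hP : P.SingleEvent G) (hQ : Q.SingleEvent G) :
    (extChoice P Q).SingleEvent G :=
  extChoiceOver (Bool.forall_bool.2 ⟨hQ, hP⟩)

end SingleEvent

section InOrder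

open AsyncDynamic

variable {n : ℕ} {f : Fin n → Sem E} {G : Fin n → Set E} {l : List (Fin n)}

theorem tickLast_inOrder (hf : ∀ j, (f j).SingleEvent (G j)) : (inOrder f l).TickLast := by
  induction l with
  | nil => exact tickLast_SKIP
  | cons j l ih => exact (hf j).tickLast.seq ih

theorem exists_mem_of_performs_inOrder (hf : ∀ j, (f j).SingleEvent (G j))
    (hs : (inOrder f l).Performs s) : ∀ a ∈ s, ∃ j ∈ l, a ∈ G j := by
  induction l generalizing s with
  | nil => simp [performs_SKIP.1 hs]
  | cons j l ih =>
    obtain hs | ⟨s₁, s₂, rfl, h₁, h₂⟩ := performs_seq.1 hs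
    · exact fun a ha => ⟨j, by simp, (hf j).mem_of_performs s hs a ha⟩
    · obtain ⟨b, hb, rfl⟩ := (hf j).exists_of_terminates h₁
      simp only [List.singleton_append, List.forall_mem_cons, List.exists_mem_cons_iff]
      exact ⟨.inl hb, fun a ha => .inr (ih h₂ a ha)⟩

theorem terminates_inOrder (hf : ∀ j, (f j).SingleEvent (G j))
    (hs : (inOrder f l).Terminates s) :
    (∀ a ∈ s, ∃ j ∈ l, a ∈ G j) ∧ ∀ j ∈ l, ∃ a ∈ s, a ∈ G j := by
  induction l generalizing s with
  | nil => simp [terminates_SKIP.1 hs]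
  | cons j l ih =>
    obtain ⟨s₁, s₂, rfl, h₁, h₂⟩ := (hf j).tickLast.exists_of_terminates_seq hs
    obtain ⟨b, hb, rfl⟩ := (hf j).exists_of_terminates h₁
    obtain ⟨hsub, hsup⟩ := ih h₂
    simp only [List.singleton_append, List.forall_mem_cons, List.exists_mem_cons_iff]
    exact ⟨⟨.inl hb, fun a ha => .inr (hsub a ha)⟩, .inl hb, fun k hk => .inr (hsup k hk)⟩

theorem refuses_inOrder (hf : ∀ j, (f j).SingleEvent (G j)) (hl : l.Nodup)
    (hs : (inOrder f l).Refuses s Y) :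
    ∃ j ∈ l, (f j).Refuses [] Y ∧ ∀ a ∈ s, ∃ k ∈ l, k ≠ j ∧ a ∈ G k := by
  induction l generalizing s with
  | nil => exact absurd hs not_refuses_SKIP
  | cons i l ih =>
    obtain ⟨hi, hl⟩ := List.nodup_cons.1 hl
    obtain hs | ⟨s₁, s₂, rfl, h₁, h₂⟩ := refuses_seq.1 hs
    · obtain rfl := (hf i).eq_nil_of_refuses s Y hs
      exact ⟨i, by simp, hs, by simp⟩
    · obtain ⟨b, hb, rfl⟩ := (hf i).exists_of_terminates h₁
      obtain ⟨j, hj, hY, hsub⟩ := ih hl h₂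
      refine ⟨j, by simp [hj], hY, ?_⟩
      simp only [List.singleton_append, List.forall_mem_cons, List.exists_mem_cons_iff]
      exact ⟨.inl ⟨fun h => hi (h ▸ hj), hb⟩, fun a ha => .inr (hsub a ha)⟩

end InOrder

end Sem

namespace AsyncDynamic

section Events

variable {E : Type u} {n : ℕ} (M : AsyncDynamic.{u, v} E n)

/-- The events by which the pair `(i, j)` performs a given activity. -/
def pairEvents : Activity → Fin n → Fin n → Set E
  | .sending, i, j => Set.range (M.send i j)
  | .receiving, i, j => Set.range (M.receive i j)
  | .turningOn, i, j => {M.turnOn i j}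
  | .turningOff, i, j => {M.turnOff i j}
  | .timingOut, i, j => {M.timeout i j}

/-- The participant that takes part in an activity of the pair `(i, j)`. -/
def owner : Activity → Fin n → Fin n → Fin n
  | .sending, i, _ | .turningOn, i, _ | .turningOff, i, _ => i
  | .receiving, _, j | .timingOut, _, j => j

/-- An event determines its activity and the pair in `C` that performs it. -/
def Separated : Prop :=
  ∀ ⦃k k' : Activity⦄ ⦃i j i' j' : Fin n⦄ ⦃a : E⦄, (i, j) ∈ M.C → (i', j') ∈ M.C →
    a ∈ M.pairEvents k i j → a ∈ M.pairEvents k' i' j' → k = k' ∧ i = i' ∧ j = j'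

variable {M} {V : Network E n} {i j i' j' : Fin n}

theorem mem_events_iff {k : Activity} {a : E} :
    a ∈ M.events k ↔ ∃ i j, (i, j) ∈ M.C ∧ a ∈ M.pairEvents k i j := by
  cases k <;> rfl

theorem owner_mem_participants (k : Activity) (hC : (i, j) ∈ M.C) :
    owner k i j ∈ M.participants := by
  cases k
  exacts [⟨j, .inl hC⟩, ⟨i, .inr hC⟩, ⟨j, .inl hC⟩, ⟨j, .inl hC⟩, ⟨i, .inr hC⟩]

namespace StructurallyCompliant

variable (h : M.StructurallyCompliant V)
include h

theorem participants_nonempty (hn : 0 < n) : M.participants.Nonempty := by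
  obtain hi | ⟨i, j, hC, -⟩ := h.partition_cover.ge (Set.mem_univ (⟨0, hn⟩ : Fin n))
  · exact ⟨_, hi⟩
  · exact ⟨i, j, .inl hC⟩

theorem owner_ne_link (k : Activity) (hC : (i, j) ∈ M.C) (hC' : (i', j') ∈ M.C) :
    owner k i j ≠ M.link i' j' :=
  (Set.disjoint_iff_inter_eq_empty.2 h.partition_disjoint).ne_of_mem
    (owner_mem_participants k hC) ⟨i', j', hC', rfl⟩

theorem pairEvents_subset_link (k : Activity) (hC : (i, j) ∈ M.C) :
    M.pairEvents k i j ⊆ V.A (M.link i j) ∩ V.Voc := by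
  intro a ha
  rw [h.controlled_alpha_transport_entity i j hC]
  cases k <;> simp_all [pairEvents]

theorem pairEvents_subset_owner (k : Activity) (hC : (i, j) ∈ M.C) :
    M.pairEvents k i j ⊆ V.A (owner k i j) ∩ V.Voc := by
  intro a ha
  rw [h.controlled_alpha_participant _ (owner_mem_participants k hC)]
  cases k with
  | sending => exact .inl (.inl (.inl ⟨j, hC, ha⟩))
  | receiving => exact .inl (.inl (.inr ⟨i, hC, ha⟩))
  | turningOn => exact .inl (.inr ⟨j, hC, .inl ha⟩)
  | turningOff => exact .inl (.inr ⟨j, hC, .inr ha⟩)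
  | timingOut => exact .inr ⟨i, hC, ha⟩

theorem separated (hV : V.Live) : M.Separated := by
  intro k k' i j i' j' a hC hC' ha ha'
  constructor
  · by_contra hk
    exact (h.mutually_disjoint_events k k' hk).subset
      ⟨mem_events_iff.2 ⟨i, j, hC, ha⟩, mem_events_iff.2 ⟨i', j', hC', ha'⟩⟩
  · by_contra hne
    have hlink : M.link i j ≠ M.link i' j' := fun he => hne (M.link_unique i j i' j' hC hC' he)
    exact (hV.tripleDisjoint _ _ _ (h.owner_ne_link k hC hC) hlink
      (h.owner_ne_link k hC hC')).subset ⟨⟨(h.pairEvents_subset_owner k hC ha).1,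
        (h.pairEvents_subset_link k hC ha).1⟩, (h.pairEvents_subset_link k' hC' ha').1⟩

end StructurallyCompliant

end Events

section Times

variable {E : Type u} {n : ℕ} (M : AsyncDynamic.{u, v} E n)

/-- The time, as a position in the trace `t`, at which the pair `(i, j)` last performed the activity
`k`. -/
noncomputable def lastTime (k : Activity) (i j : Fin n) (t : List E) : ℕ :=
  lastPos (M.pairEvents k i j) t

/-- The link from `i` to `j` has been turned on since it was last turned off. -/
def IsOn (i j : Fin n) (t : List E) : Prop :=
  M.lastTime .turningOff i j t < M.lastTime .turningOn i j t

/-- The peers to which `i` has a link that is on. -/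
def onPeers (i : Fin n) (t : List E) : Set (Fin n) :=
  {j | (i, j) ∈ M.C ∧ M.IsOn i j t}

/-- Nothing has been sent from `i` to `j` since `j` last received from `i` or the link was last
turned on, so that the link holds no data. -/
def Drained (i j : Fin n) (t : List E) : Prop :=
  M.lastTime .sending i j t < max (M.lastTime .receiving i j t) (M.lastTime .turningOn i j t)

/-- Over each of its links that are on, `i` has sent since it last received from `j` and since this
link was last turned on. -/
def SentSince (i j : Fin n) (t : List E) : Prop :=
  ∀ h ∈ M.onPeers i t,
    max (M.lastTime .receiving j i t) (M.lastTime .turningOn i h t) < M.lastTime .sending i h t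

/-- The events other than those that switch links. -/
def dataEvents : Set E :=
  M.events .sending ∪ M.events .receiving ∪ M.events .timingOut

variable {M} {i j : Fin n} {s t : List E} {a : E}

theorem send_mem_dataEvents (hC : (i, j) ∈ M.C) (d : M.Data i j) : M.send i j d ∈ M.dataEvents :=
  .inl (.inl ⟨i, j, hC, d, rfl⟩)

theorem receive_mem_dataEvents (hC : (i, j) ∈ M.C) (d : M.Data i j) :
    M.receive i j d ∈ M.dataEvents :=
  .inl (.inr ⟨i, j, hC, d, rfl⟩)

theorem timeout_mem_dataEvents (hC : (i, j) ∈ M.C) : M.timeout i j ∈ M.dataEvents :=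
  .inr ⟨i, j, hC, rfl⟩

theorem not_isOn_nil : ¬ M.IsOn i j [] := by
  simp [IsOn, lastTime]

theorem isOn_append_iff
    (hs : ∀ a ∈ s, a ∉ M.pairEvents .turningOn i j ∧ a ∉ M.pairEvents .turningOff i j) :
    M.IsOn i j (t ++ s) ↔ M.IsOn i j t := by
  simp only [IsOn, lastTime]
  rw [lastPos_append_of_notMem fun a ha => (hs a ha).1,
    lastPos_append_of_notMem fun a ha => (hs a ha).2]

namespace Separated

variable (hM : M.Separated)
include hM

theorem notMem_pairEvents {k k' : Activity} {i' j' : Fin n} (hC : (i, j) ∈ M.C)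
    (hC' : (i', j') ∈ M.C) (ha : a ∈ M.pairEvents k i j) (hne : ¬ (k = k' ∧ i = i' ∧ j = j')) :
    a ∉ M.pairEvents k' i' j' :=
  fun ha' => hne (hM hC hC' ha ha')

theorem notMem_switchEvents (hC : (i, j) ∈ M.C) (ha : a ∈ M.dataEvents) :
    a ∉ M.pairEvents .turningOn i j ∧ a ∉ M.pairEvents .turningOff i j := by
  obtain ⟨k, hk, hk', i', j', hC', ha'⟩ : ∃ k, k ≠ Activity.turningOn ∧ k ≠ .turningOff ∧
      ∃ i' j', (i', j') ∈ M.C ∧ a ∈ M.pairEvents k i' j' := by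
    obtain (ha | ha) | ha := ha
    exacts [⟨.sending, nofun, nofun, ha⟩, ⟨.receiving, nofun, nofun, ha⟩,
      ⟨.timingOut, nofun, nofun, ha⟩]
  exact ⟨hM.notMem_pairEvents hC' hC ha' fun h => hk h.1,
    hM.notMem_pairEvents hC' hC ha' fun h => hk' h.1⟩

theorem isOn_append_iff_of_dataEvents (hC : (i, j) ∈ M.C) (hs : ∀ a ∈ s, a ∈ M.dataEvents) :
    M.IsOn i j (t ++ s) ↔ M.IsOn i j t :=
  isOn_append_iff fun a ha => hM.notMem_switchEvents hC (hs a ha)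

theorem onPeers_append_eq (hs : ∀ a ∈ s, a ∈ M.dataEvents) :
    M.onPeers i (t ++ s) = M.onPeers i t :=
  Set.ext fun _ => and_congr_right fun hC => hM.isOn_append_iff_of_dataEvents hC hs

theorem lastTime_concat_lt {k k' : Activity} (hC : (i, j) ∈ M.C) (ha : a ∈ M.pairEvents k i j)
    (hk : k ≠ k') : M.lastTime k' i j (t ++ [a]) < M.lastTime k i j (t ++ [a]) :=
  lastPos_append_lt_lastPos_append
    (by simpa using hM.notMem_pairEvents hC hC ha fun h => hk h.1) ⟨a, by simp, ha⟩

end Separated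

end Times

section Transport

open Sem

variable {E : Type u} {n : ℕ} (M : AsyncDynamic.{u, v} E n)

/-- What the trace `t` tells about the link from `i` to `j` when the link is in the given state. -/
def Consistent (i j : Fin n) (t : List E) : TState (M.Data i j) → Prop
  | .off => ¬ M.IsOn i j t
  | .on => M.IsOn i j t ∧ M.Drained i j t
  | .onF _ => M.IsOn i j t

/-- `Y` contains none of the events that the link from `i` to `j` offers in the given state. -/
def OffersOutside (i j : Fin n) (Y : Set E) : TState (M.Data i j) → Prop
  | .off => M.turnOn i j ∉ Y ∧ M.timeout i j ∉ Y
  | .on => M.turnOff i j ∉ Y ∧ ∀ d, M.send i j d ∉ Y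
  | .onF d => M.turnOff i j ∉ Y ∧ (∀ d', M.send i j d' ∉ Y) ∧ M.receive i j d ∉ Y

variable {M} {i j : Fin n} {t : List E} {Y : Set E} {q : List E}

namespace Separated

variable (hM : M.Separated) (hC : (i, j) ∈ M.C)
include hM hC

theorem consistent_concat_turnOn : M.Consistent i j (q ++ [M.turnOn i j]) .on :=
  ⟨hM.lastTime_concat_lt hC rfl nofun, lt_max_of_lt_right (hM.lastTime_concat_lt hC rfl nofun)⟩

theorem consistent_concat_turnOff : M.Consistent i j (q ++ [M.turnOff i j]) .off :=
  fun hon => lt_asymm hon (hM.lastTime_concat_lt hC rfl nofun)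

theorem consistent_concat_timeout (hq : M.Consistent i j q .off) :
    M.Consistent i j (q ++ [M.timeout i j]) .off :=
  (hM.isOn_append_iff_of_dataEvents hC (by simpa using timeout_mem_dataEvents hC)).not.2 hq

theorem consistent_concat_send (hq : M.IsOn i j q) (d : M.Data i j) :
    M.Consistent i j (q ++ [M.send i j d]) (.onF d) :=
  (hM.isOn_append_iff_of_dataEvents hC (by simpa using send_mem_dataEvents hC d)).2 hq

theorem consistent_concat_receive (hq : M.IsOn i j q) (d : M.Data i j) :
    M.Consistent i j (q ++ [M.receive i j d]) .on :=
  ⟨(hM.isOn_append_iff_of_dataEvents hC (by simpa using receive_mem_dataEvents hC d)).2 hq,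
    lt_max_of_lt_left (hM.lastTime_concat_lt hC ⟨d, rfl⟩ nofun)⟩

theorem exists_consistent_of_refuses_transportSpec (h : (M.TransportSpec i j).Refuses t Y) :
    ∃ st, M.Consistent i j t st ∧ M.OffersOutside i j Y st := by
  suffices ∀ st q t, M.Consistent i j q st →
      (muFamily _ st : Sem E).Refuses t Y →
      ∃ st', M.Consistent i j (q ++ t) st' ∧ M.OffersOutside i j Y st' from
    this .off [] t not_isOn_nil h
  apply muFamily_induction fun X : TState (M.Data i j) → Sem E => ∀ st q t,
    M.Consistent i j q st → (X st).Refuses t Y →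
      ∃ st', M.Consistent i j (q ++ t) st' ∧ M.OffersOutside i j Y st'
  · rintro P hP st q t hq ⟨m, ht⟩
    exact hP m st q t hq ht
  · exact fun st q t _ ht => absurd ht not_refuses_DIV
  · rintro X hX st q (_ | ⟨a, t⟩) hq ht
    · refine ⟨st, by simpa using hq, ?_⟩
      cases st <;>
        simpa only [OffersOutside, refuses_extChoice_nil, refuses_extChoiceOver_nil,
          refuses_pre_nil] using ht
    · simp only [List.append_cons q a t]
      cases st <;> simp only [refuses_extChoice_cons, refuses_extChoiceOver_cons,
        refuses_pre_cons] at ht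
      · obtain ⟨rfl, ht⟩ | ⟨d, rfl, ht⟩ := ht
        · exact hX _ _ _ (hM.consistent_concat_turnOff hC) ht
        · exact hX _ _ _ (hM.consistent_concat_send hC hq.1 d) ht
      · obtain ⟨rfl, ht⟩ | ⟨d, rfl, ht⟩ | ⟨rfl, ht⟩ := ht
        · exact hX _ _ _ (hM.consistent_concat_turnOff hC) ht
        · exact hX _ _ _ (hM.consistent_concat_send hC hq d) ht
        · exact hX _ _ _ (hM.consistent_concat_receive hC hq _) ht
      · obtain ⟨rfl, ht⟩ | ⟨rfl, ht⟩ := ht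
        · exact hX _ _ _ (hM.consistent_concat_turnOn hC) ht
        · exact hX _ _ _ (hM.consistent_concat_timeout hC hq) ht

end Separated

end Transport

section Participants

open Sem

variable {E : Type u} {n : ℕ} (M : AsyncDynamic.{u, v} E n)

/-- The ways in which participant `i`, after the trace `t`, can wait for events outside `Y`: to turn
on a link that is off, to turn off or send over a link that is on, or, having sent over all links
that are on, to receive data or time out. -/
inductive Waiting (i : Fin n) (t : List E) (Y : Set E) : Prop
  | turnOn {j : Fin n} (hC : (i, j) ∈ M.C) (hj : j ∉ M.onPeers i t) (hY : M.turnOn i j ∉ Y)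
  | turnOff {j : Fin n} (hj : j ∈ M.onPeers i t) (hY : M.turnOff i j ∉ Y)
  | send {j : Fin n} (hj : j ∈ M.onPeers i t) (d : M.Data i j) (hY : M.send i j d ∉ Y)
  | receive {j : Fin n} (hC : (j, i) ∈ M.C) (hs : M.SentSince i j t)
      (hY : ∀ d, M.receive j i d ∉ Y) (hY' : M.timeout j i ∉ Y)

variable {M} {i j : Fin n} {l : List (Fin n)} {q s t : List E} {Y : Set E}

theorem mem_outPeers : j ∈ M.outPeers i l ↔ j ∈ l ∧ (i, j) ∈ M.C := by
  simp [outPeers]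

theorem mem_inPeers : j ∈ M.inPeers i l ↔ j ∈ l ∧ (j, i) ∈ M.C := by
  simp [inPeers]

theorem singleEvent_turnOn :
    (pre (M.turnOn i j) SKIP).SingleEvent (M.pairEvents .turningOn i j) :=
  .pre_SKIP rfl

theorem singleEvent_turnOff :
    (pre (M.turnOff i j) SKIP).SingleEvent (M.pairEvents .turningOff i j) :=
  .pre_SKIP rfl

theorem singleEvent_send :
    (intChoiceOver fun d => pre (M.send i j d) SKIP).SingleEvent (M.pairEvents .sending i j) :=
  .intChoiceOver fun d => .pre_SKIP ⟨d, rfl⟩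

theorem singleEvent_receive :
    (extChoice (extChoiceOver fun d => pre (M.receive j i d) SKIP)
      (pre (M.timeout j i) SKIP)).SingleEvent
        (M.pairEvents .receiving j i ∪ M.pairEvents .timingOut j i) :=
  .extChoice (.extChoiceOver fun d => .pre_SKIP (.inl ⟨d, rfl⟩)) (.pre_SKIP (.inr rfl))

theorem mem_dataEvents_of_mem_outPeers {a : E}
    (h : ∃ j ∈ M.outPeers i l, a ∈ M.pairEvents .sending i j) : a ∈ M.dataEvents := by
  obtain ⟨j, hj, d, rfl⟩ := h
  exact send_mem_dataEvents (mem_outPeers.1 hj).2 d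

theorem mem_dataEvents_of_mem_inPeers {a : E}
    (h : ∃ j ∈ M.inPeers i l, a ∈ M.pairEvents .receiving j i ∪ M.pairEvents .timingOut j i) :
    a ∈ M.dataEvents := by
  obtain ⟨j, hj, ⟨d, rfl⟩ | rfl⟩ := h
  · exact receive_mem_dataEvents (mem_inPeers.1 hj).2 d
  · exact timeout_mem_dataEvents (mem_inPeers.1 hj).2

theorem mem_dataEvents_of_performs_sendReceive (hs : (M.SendReceive i l).Performs s) :
    ∀ a ∈ s, a ∈ M.dataEvents := by
  refine mu_induction (fun P : Sem E => ∀ s, P.Performs s → ∀ a ∈ s, a ∈ M.dataEvents)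
    (fun P hP s ⟨m, hs⟩ => hP m s hs) (fun s hs => ?_) (fun P hP s hs => ?_) s hs
  · simp [show s = [] by simpa [Performs, DIV] using hs]
  · obtain hs | ⟨s₁, s', rfl, h₁, hs'⟩ := performs_seq.1 hs
    · exact fun a ha => mem_dataEvents_of_mem_outPeers
        (exists_mem_of_performs_inOrder (fun _ => singleEvent_send) hs a ha)
    have hs₁ : ∀ a ∈ s₁, a ∈ M.dataEvents := fun a ha => mem_dataEvents_of_mem_outPeers
      ((terminates_inOrder (fun _ => singleEvent_send) h₁).1 a ha)
    obtain hs' | ⟨s₂, s₃, rfl, h₂, h₃⟩ := performs_seq.1 hs'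
    · exact List.forall_mem_append.2 ⟨hs₁, fun a ha => mem_dataEvents_of_mem_inPeers
        (exists_mem_of_performs_inOrder (fun _ => singleEvent_receive) hs' a ha)⟩
    · have hs₂ : ∀ a ∈ s₂, a ∈ M.dataEvents := fun a ha => mem_dataEvents_of_mem_inPeers
        ((terminates_inOrder (fun _ => singleEvent_receive) h₂).1 a ha)
      exact List.forall_mem_append.2 ⟨hs₁, List.forall_mem_append.2 ⟨hs₂, hP s₃ h₃⟩⟩

theorem nonTerminating_sendReceive : (M.SendReceive i l).NonTerminating :=
  mu_induction NonTerminating (fun _ hP s ⟨m, hs⟩ => hP m s hs) (fun s => by simp [DIV])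
    fun _ hP => (tickLast_inOrder fun _ => singleEvent_send).nonTerminating_seq
      ((tickLast_inOrder fun _ => singleEvent_receive).nonTerminating_seq hP)

theorem mem_dataEvents_of_terminates_interrupt
    (hs : (interrupt (M.SendReceive i l) (intChoice SKIP STOP)).Terminates s) :
    ∀ a ∈ s, a ∈ M.dataEvents := by
  obtain ⟨s₁, s₂, rfl, h₁, h₂⟩ :=
    exists_of_terminates_interrupt nonTerminating_sendReceive.not_terminates hs
  rw [terminates_intChoice_SKIP_STOP.1 h₂, List.append_nil]
  exact mem_dataEvents_of_performs_sendReceive h₁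

theorem refuses_sendReceive_of_refuses_interrupt
    (ht : (interrupt (M.SendReceive i l) (intChoice SKIP STOP)).Refuses t Y) :
    (M.SendReceive i l).Refuses t Y := by
  obtain ht | ⟨_, _, -, hne, h⟩ :=
    refuses_or_of_refuses_interrupt nonTerminating_sendReceive.not_terminates ht
  · exact ht
  · exact absurd (eq_nil_of_refuses_intChoice_SKIP_STOP h) hne

namespace Separated

variable (hM : M.Separated)
include hM

theorem isOn_append_iff_of_outPeers_ne {k : Activity} (hC : (i, j) ∈ M.C)
    (hs : ∀ a ∈ s, ∃ h ∈ M.outPeers i l, h ≠ j ∧ a ∈ M.pairEvents k i h) :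
    M.IsOn i j (q ++ s) ↔ M.IsOn i j q := by
  refine isOn_append_iff fun a ha => ?_
  obtain ⟨h, hh, hne, hah⟩ := hs a ha
  have hC' := (mem_outPeers.1 hh).2
  exact ⟨hM.notMem_pairEvents hC' hC hah fun he => hne he.2.2,
    hM.notMem_pairEvents hC' hC hah fun he => hne he.2.2⟩

theorem lastTime_append_lt_of_outPeers {k k' : Activity} (hC : (i, j) ∈ M.C) (hk : k ≠ k')
    (hs : ∀ a ∈ s, ∃ h ∈ M.outPeers i l, a ∈ M.pairEvents k i h)
    (hj : ∃ a ∈ s, a ∈ M.pairEvents k i j) :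
    M.lastTime k' i j (q ++ s) < M.lastTime k i j (q ++ s) := by
  refine lastPos_append_lt_lastPos_append (fun a ha => ?_) hj
  obtain ⟨h, hh, hah⟩ := hs a ha
  exact hM.notMem_pairEvents (mem_outPeers.1 hh).2 hC hah fun he => hk he.1

theorem waiting_of_refuses_onDetect (hl : l.Nodup) (hq : M.onPeers i q = ∅)
    (hs : (M.OnDetect i l).Refuses s Y) : M.Waiting i (q ++ s) Y := by
  obtain ⟨j, hj, hY, hne⟩ := refuses_inOrder (fun _ => singleEvent_turnOn) (hl.filter _) hs
  have hC := (mem_outPeers.1 hj).2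
  exact .turnOn hC
    (fun hon => hq.subset ⟨hC, (hM.isOn_append_iff_of_outPeers_ne hC hne).1 hon.2⟩)
    (refuses_pre_nil.1 hY)

theorem waiting_of_refuses_offDetect (hl : l.Nodup) (hq : M.onPeers i q = {j | j ∈ M.outPeers i l})
    (hs : (M.OffDetect i l).Refuses s Y) : M.Waiting i (q ++ s) Y := by
  obtain ⟨j, hj, hY, hne⟩ := refuses_inOrder (fun _ => singleEvent_turnOff) (hl.filter _) hs
  have hC := (mem_outPeers.1 hj).2
  exact .turnOff ⟨hC, (hM.isOn_append_iff_of_outPeers_ne hC hne).2 (hq.ge hj).2⟩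
    (refuses_pre_nil.1 hY)

theorem onPeers_append_of_terminates_onDetect (hq : M.onPeers i q = ∅)
    (hs : (M.OnDetect i l).Terminates s) : M.onPeers i (q ++ s) = {j | j ∈ M.outPeers i l} := by
  obtain ⟨hsub, hsup⟩ := terminates_inOrder (fun _ => singleEvent_turnOn) hs
  ext j
  constructor
  · rintro ⟨hC, hon⟩
    by_contra hj
    have hne : ∀ a ∈ s, ∃ h ∈ M.outPeers i l, h ≠ j ∧ a ∈ M.pairEvents .turningOn i h :=
      fun a ha => (hsub a ha).imp fun h hh => ⟨hh.1, fun he => hj (he ▸ hh.1), hh.2⟩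
    exact hq.subset ⟨hC, (hM.isOn_append_iff_of_outPeers_ne hC hne).1 hon⟩
  · intro hj
    have hC := (mem_outPeers.1 hj).2
    exact ⟨hC, hM.lastTime_append_lt_of_outPeers hC nofun hsub (hsup j hj)⟩

theorem onPeers_append_of_terminates_offDetect (hq : M.onPeers i q = {j | j ∈ M.outPeers i l})
    (hs : (M.OffDetect i l).Terminates s) : M.onPeers i (q ++ s) = ∅ := by
  obtain ⟨hsub, hsup⟩ := terminates_inOrder (fun _ => singleEvent_turnOff) hs
  refine Set.eq_empty_of_forall_notMem fun j ⟨hC, hon⟩ => ?_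
  by_cases hj : j ∈ M.outPeers i l
  · exact lt_asymm hon (hM.lastTime_append_lt_of_outPeers hC nofun hsub (hsup j hj))
  · have hne : ∀ a ∈ s, ∃ h ∈ M.outPeers i l, h ≠ j ∧ a ∈ M.pairEvents .turningOff i h :=
      fun a ha => (hsub a ha).imp fun h hh => ⟨hh.1, fun he => hj (he ▸ hh.1), hh.2⟩
    exact hj (hq.subset ⟨hC, (hM.isOn_append_iff_of_outPeers_ne hC hne).1 hon⟩)

theorem waiting_of_refuses_send (hl : l.Nodup) (hq : M.onPeers i q = {j | j ∈ M.outPeers i l})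
    (hs : (M.Send i l).Refuses s Y) : M.Waiting i (q ++ s) Y := by
  obtain ⟨j, hj, ⟨d, hd⟩, hne⟩ := refuses_inOrder (fun _ => singleEvent_send) (hl.filter _) hs
  refine .send ?_ d (refuses_pre_nil.1 hd)
  rw [hM.onPeers_append_eq fun a ha => mem_dataEvents_of_mem_outPeers
    ((hne a ha).imp fun h hh => ⟨hh.1, hh.2.2⟩), hq]
  exact hj

theorem sentSince_of_terminates_send (hq : M.onPeers i q = {j | j ∈ M.outPeers i l})
    (hs : (M.Send i l).Terminates s) (ht : ∀ a ∈ t, a ∈ M.dataEvents)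
    (hC : (j, i) ∈ M.C) (htj : ∀ a ∈ t, a ∉ M.pairEvents .receiving j i) :
    M.SentSince i j (q ++ (s ++ t)) := by
  obtain ⟨hsub, hsup⟩ := terminates_inOrder (fun _ => singleEvent_send) hs
  have hst : ∀ a ∈ s ++ t, a ∈ M.dataEvents :=
    List.forall_mem_append.2 ⟨fun a ha => mem_dataEvents_of_mem_outPeers (hsub a ha), ht⟩
  have hrec : ∀ a ∈ s ++ t, a ∉ M.pairEvents .receiving j i := by
    refine List.forall_mem_append.2 ⟨fun a ha => ?_, htj⟩
    obtain ⟨h, hh, hah⟩ := hsub a ha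
    exact hM.notMem_pairEvents (mem_outPeers.1 hh).2 hC hah nofun
  intro h hh
  rw [hM.onPeers_append_eq hst, hq] at hh
  obtain ⟨a, ha, hah⟩ := hsup h hh
  have hsent : ∃ a ∈ s ++ t, a ∈ M.pairEvents .sending i h :=
    ⟨a, List.mem_append_left t ha, hah⟩
  exact max_lt (lastPos_append_lt_lastPos_append hrec hsent) (lastPos_append_lt_lastPos_append
    (fun a ha => (hM.notMem_switchEvents (mem_outPeers.1 hh).2 (hst a ha)).1) hsent)

theorem waiting_of_refuses_receive (hl : l.Nodup) (hq : M.onPeers i q = {j | j ∈ M.outPeers i l})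
    (hs : (M.Send i l).Terminates s) (ht : (M.Receive i l).Refuses t Y) :
    M.Waiting i (q ++ (s ++ t)) Y := by
  obtain ⟨j, hj, hY, hne⟩ := refuses_inOrder (fun _ => singleEvent_receive) (hl.filter _) ht
  simp only [refuses_extChoice_nil, refuses_extChoiceOver_nil, refuses_pre_nil] at hY
  have hC := (mem_inPeers.1 hj).2
  refine .receive hC (hM.sentSince_of_terminates_send hq hs (fun a ha => ?_) hC fun a ha => ?_)
    hY.1 hY.2
  · exact mem_dataEvents_of_mem_inPeers ((hne a ha).imp fun h hh => ⟨hh.1, hh.2.2⟩)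
  · obtain ⟨h, hh, hhj, hah | hah⟩ := hne a ha
    · exact hM.notMem_pairEvents (mem_inPeers.1 hh).2 hC hah fun he => hhj he.2.1
    · exact hM.notMem_pairEvents (mem_inPeers.1 hh).2 hC hah nofun

theorem waiting_of_refuses_sendReceive (hl : l.Nodup)
    (hq : M.onPeers i q = {j | j ∈ M.outPeers i l}) (ht : (M.SendReceive i l).Refuses t Y) :
    M.Waiting i (q ++ t) Y := by
  refine mu_induction (fun P : Sem E => ∀ q t, M.onPeers i q = {j | j ∈ M.outPeers i l} →
    P.Refuses t Y → M.Waiting i (q ++ t) Y) (fun P hP q t hq ⟨m, ht⟩ => hP m q t hq ht)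
    (fun _ _ _ ht => absurd ht not_refuses_DIV) (fun P hP q t hq ht => ?_) q t hq ht
  obtain ht | ⟨s₁, t, rfl, h₁, ht⟩ := refuses_seq.1 ht
  · exact hM.waiting_of_refuses_send hl hq ht
  obtain ht | ⟨s₂, t, rfl, h₂, ht⟩ := refuses_seq.1 ht
  · exact hM.waiting_of_refuses_receive hl hq h₁ ht
  rw [← List.append_assoc, ← List.append_assoc]
  refine hP _ t ?_ ht
  rw [hM.onPeers_append_eq fun a ha => mem_dataEvents_of_mem_inPeers
      ((terminates_inOrder (fun _ => singleEvent_receive) h₂).1 a ha),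
    hM.onPeers_append_eq fun a ha => mem_dataEvents_of_mem_outPeers
      ((terminates_inOrder (fun _ => singleEvent_send) h₁).1 a ha), hq]

theorem waiting_of_refuses_participantSpec (hl : l.Nodup)
    (ht : (M.ParticipantSpec i l).Refuses t Y) : M.Waiting i t Y := by
  refine mu_induction (fun P : Sem E => ∀ q t, M.onPeers i q = ∅ → P.Refuses t Y →
    M.Waiting i (q ++ t) Y) (fun P hP q t hq ⟨m, ht⟩ => hP m q t hq ht)
    (fun _ _ _ ht => absurd ht not_refuses_DIV) (fun P hP q t hq ht => ?_) [] t
    (Set.eq_empty_of_forall_notMem fun j hj => not_isOn_nil hj.2) ht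
  obtain ht | ⟨s₁, t, rfl, h₁, ht⟩ := refuses_seq.1 ht
  · exact hM.waiting_of_refuses_onDetect hl hq ht
  have hq₁ := hM.onPeers_append_of_terminates_onDetect hq h₁
  rw [← List.append_assoc]
  obtain ht | ⟨s₂, t, rfl, h₂, ht⟩ := refuses_seq.1 ht
  · exact hM.waiting_of_refuses_sendReceive hl hq₁ (refuses_sendReceive_of_refuses_interrupt ht)
  have hq₂ := (hM.onPeers_append_eq (mem_dataEvents_of_terminates_interrupt h₂)).trans hq₁
  rw [← List.append_assoc]
  obtain ht | ⟨s₃, t, rfl, h₃, ht⟩ := refuses_seq.1 ht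
  · exact hM.waiting_of_refuses_offDetect hl hq₂ ht
  rw [← List.append_assoc]
  exact hP _ t (hM.onPeers_append_of_terminates_offDetect hq₂ h₃) ht

end Separated

end Participants

end AsyncDynamic

namespace Network

open Sem

variable {E : Type u} {n : ℕ} (V : Network E n) {c : Fin n} {s : List E}
  {R : Fin n → Set (Obs E)} {a : E}

open Classical in
/-- The part of the network trace `s` that consists of the events that component `c` shares with
other components. -/
noncomputable def vocTrace (c : Fin n) (s : List E) : List E :=
  s.filter fun a => decide (a ∈ V.A c ∩ V.Voc)

/-- A deadlock of the network as seen through the abstractions of its components: after the network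
trace `s`, each component `c` can refuse `Y c`, and every shared event is thereby refused. -/
structure AbsDeadlocked (s : List E) (Y : Fin n → Set E) : Prop where
  refuses : ∀ c, (V.Abs c).Refuses (V.vocTrace c s) (Y c)
  mem_or_mem : ∀ ⦃c c' a⦄, c ≠ c' → a ∈ V.A c → a ∈ V.A c' → a ∈ Y c ∨ a ∈ Y c'

variable {V}

theorem Deadlocked.exists_refusal (hD : V.Deadlocked R) (ha : a ∈ V.A c) :
    ∃ k, a ∈ V.A k ∧ some a ∈ R k :=
  Set.mem_iUnion.1 (hD.ge (Set.mem_iUnion.2 ⟨c, ha⟩))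

open Classical in
theorem IsState.refuses (hs : V.IsState s R) (hc : (V.P c).NonTerminating) :
    (V.P c).Refuses (s.filter fun a => decide (a ∈ V.A c)) {a | a ∈ V.A c → some a ∈ R c} := by
  have h := (V.healthy c).refuse_impossible _ _ {x | ∀ a ∈ V.A c, x ≠ some a} (hs c) <| by
    rintro (_ | a) hx hmem
    · exact hc _ hmem
    · exact hx a (V.events_mem c _ hmem a (by simp)) rfl
  refine (V.healthy c).subset_closed _ _ _ h (Set.insert_subset (.inr nofun) ?_)
  rintro _ ⟨a, ha, rfl⟩
  by_cases hA : a ∈ V.A c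
  · exact .inl (ha hA)
  · exact .inr fun b hb hab => hA (Option.some_injective E hab ▸ hb)

open Classical in
theorem vocTrace_eq_filter_filter : V.vocTrace c s =
    (s.filter fun a => decide (a ∈ V.A c)).filter fun a => decide (a ∉ V.Vocᶜ) := by
  rw [vocTrace, List.filter_filter]
  exact List.filter_congr fun a _ => by
    by_cases hA : a ∈ V.A c <;> by_cases hV : a ∈ V.Voc <;> simp [hA, hV]

theorem exists_absDeadlocked (hV : V.Live) (hs : V.IsState s R) (hD : V.Deadlocked R) :
    ∃ Y, V.AbsDeadlocked s Y := by
  refine ⟨fun c => {a | a ∈ V.A c → some a ∈ R c}, fun c => ?_, fun c c' a hne hc hc' => ?_⟩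
  · have hvoc : V.Vocᶜ ⊆ {a | a ∈ V.A c → some a ∈ R c} := fun a ha hc => by
      obtain ⟨k, hk, hR⟩ := hD.exists_refusal hc
      obtain rfl : k = c := by_contra fun hne => ha ⟨k, c, hne, hk, hc⟩
      exact hR
    rw [vocTrace_eq_filter_filter, Abs]
    convert (hs.refuses (hV.nonTerminating c)).hide hvoc
  · obtain ⟨k, hk, hR⟩ := hD.exists_refusal hc
    by_cases h : k = c
    · exact .inl fun _ => h ▸ hR
    by_cases h' : k = c'
    · exact .inr fun _ => h' ▸ hR
    exact ((hV.tripleDisjoint c c' k hne (Ne.symm h') (Ne.symm h)).subset ⟨⟨hc, hc'⟩, hk⟩).elim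

theorem lastPos_vocTrace_lt_iff {α β : Set E} (hα : α ⊆ V.A c ∩ V.Voc) (hβ : β ⊆ V.A c ∩ V.Voc) :
    lastPos α (V.vocTrace c s) < lastPos β (V.vocTrace c s) ↔ lastPos α s < lastPos β s :=
  lastPos_filter_lt_lastPos_filter_iff (fun _ hx => by simpa using hα hx)
    fun _ hx => by simpa using hβ hx

end Network

namespace AsyncDynamic

section Starvation

variable {E : Type u} {n : ℕ} (M : AsyncDynamic.{u, v} E n)

/-- Participant `i` waits for data from `j`, whose link to `i` is on and holds no data. -/
structure Starves (i j : Fin n) (t : List E) : Prop where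
  mem_onPeers : i ∈ M.onPeers j t
  drained : M.Drained j i t
  sentSince : M.SentSince i j t

variable {M} {V : Network E n} {S : Fin n → List (Fin n)} {i j k : Fin n} {s t : List E}
  {Y : Set E}

theorem Starves.lastTime_receiving_lt (hij : M.Starves i j t) (hjk : M.Starves j k t) :
    M.lastTime .receiving k j t < M.lastTime .receiving j i t := by
  have hsent := max_lt_iff.1 (hjk.sentSince i hij.mem_onPeers)
  exact hsent.1.trans ((lt_max_iff.1 hij.drained).resolve_right hsent.2.not_gt)

namespace StructurallyCompliant

variable (h : M.StructurallyCompliant V)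
include h

theorem onPeers_vocTrace : M.onPeers i (V.vocTrace i s) = M.onPeers i s :=
  Set.ext fun _ => and_congr_right fun hC => Network.lastPos_vocTrace_lt_iff
    (h.pairEvents_subset_owner .turningOff hC) (h.pairEvents_subset_owner .turningOn hC)

theorem sentSince_of_vocTrace (hC : (j, i) ∈ M.C) (hs : M.SentSince i j (V.vocTrace i s)) :
    M.SentSince i j s := by
  intro k hk
  have hsend := h.pairEvents_subset_owner .sending hk.1
  have hlt := max_lt_iff.1 (hs k (h.onPeers_vocTrace.ge hk))
  exact max_lt
    ((Network.lastPos_vocTrace_lt_iff (h.pairEvents_subset_owner .receiving hC) hsend).1 hlt.1)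
    ((Network.lastPos_vocTrace_lt_iff (h.pairEvents_subset_owner .turningOn hk.1) hsend).1 hlt.2)

theorem waiting_of_vocTrace (hw : M.Waiting i (V.vocTrace i s) Y) : M.Waiting i s Y := by
  cases hw with
  | turnOn hC hj hY => exact .turnOn hC (h.onPeers_vocTrace ▸ hj) hY
  | turnOff hj hY => exact .turnOff (h.onPeers_vocTrace ▸ hj) hY
  | send hj d hY => exact .send (h.onPeers_vocTrace ▸ hj) d hY
  | receive hC hs hY hY' => exact .receive hC (h.sentSince_of_vocTrace hC hs) hY hY'

theorem consistent_of_vocTrace (hC : (i, j) ∈ M.C) {st : TState (M.Data i j)}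
    (hst : M.Consistent i j (V.vocTrace (M.link i j) s) st) : M.Consistent i j s st := by
  have hlt : ∀ {k k'}, M.lastTime k i j (V.vocTrace (M.link i j) s) <
      M.lastTime k' i j (V.vocTrace (M.link i j) s) ↔
        M.lastTime k i j s < M.lastTime k' i j s :=
    Network.lastPos_vocTrace_lt_iff (h.pairEvents_subset_link _ hC) (h.pairEvents_subset_link _ hC)
  cases st <;> simpa only [Consistent, IsOn, Drained, lt_max_iff, hlt] using hst

theorem exists_starves (hV : V.Live) (hB : M.BehaviourallyCompliant V S) {Y : Fin n → Set E}
    (hD : V.AbsDeadlocked s Y) (hi : i ∈ M.participants) : ∃ j, M.Starves i j s := by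
  have hM := h.separated hV
  have refused : ∀ {k i j a}, (i, j) ∈ M.C → a ∈ M.pairEvents k i j → a ∉ Y (owner k i j) →
      a ∈ Y (M.link i j) := fun hC ha haY =>
    (hD.mem_or_mem (h.owner_ne_link _ hC hC) (h.pairEvents_subset_owner _ hC ha).1
      (h.pairEvents_subset_link _ hC ha).1).resolve_left haY
  have link_state : ∀ {i j}, (i, j) ∈ M.C →
      ∃ st, M.Consistent i j s st ∧ M.OffersOutside i j (Y (M.link i j)) st := fun hC =>
    (hM.exists_consistent_of_refuses_transportSpec hC
      ((hB.transport _ _ hC).2 (hD.refuses _))).imp fun _ hst =>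
        ⟨h.consistent_of_vocTrace hC hst.1, hst.2⟩
  obtain @⟨j, hC, hj, hY⟩ | @⟨j, hj, hY⟩ | @⟨j, hj, d, hY⟩ | @⟨j, hC, hs, hY, hY'⟩ :=
    h.waiting_of_vocTrace (hM.waiting_of_refuses_participantSpec (hB.no_repeats i hi)
      ((hB.participant i hi).2 (hD.refuses i)))
  · obtain ⟨_ | d | _, hst, hout⟩ := link_state hC
    · exact absurd ⟨hC, hst.1⟩ hj
    · exact absurd ⟨hC, hst⟩ hj
    · exact absurd (refused (k := .turningOn) hC rfl hY) hout.1
  · obtain ⟨_ | d | _, hst, hout⟩ := link_state hj.1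
    · exact absurd (refused (k := .turningOff) hj.1 rfl hY) hout.1
    · exact absurd (refused (k := .turningOff) hj.1 rfl hY) hout.1
    · exact absurd hj.2 hst
  · obtain ⟨_ | d' | _, hst, hout⟩ := link_state hj.1
    · exact absurd (refused (k := .sending) hj.1 ⟨d, rfl⟩ hY) (hout.2 d)
    · exact absurd (refused (k := .sending) hj.1 ⟨d, rfl⟩ hY) (hout.2.1 d)
    · exact absurd hj.2 hst
  · obtain ⟨_ | d | _, hst, hout⟩ := link_state hC
    · exact ⟨j, ⟨hC, hst.1⟩, hst.2, hs⟩
    · exact absurd (refused (k := .receiving) hC ⟨d, rfl⟩ (hY d)) hout.2.2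
    · exact absurd (refused (k := .timingOut) hC rfl hY') hout.2

end StructurallyCompliant

end Starvation

end AsyncDynamic

end CSP

theorem mainTheorem3 {E : Type*} {n : ℕ} (hn : 0 < n) (V : CSP.Network E n) (hV : V.Live)
    (M : CSP.AsyncDynamic E n) (S : Fin n → List (Fin n))
    (hstruct : M.StructurallyCompliant V) (hbehav : M.BehaviourallyCompliant V S) :
    V.DeadlockFree := by
  intro s R hs hdead
  obtain ⟨Y, hY⟩ := CSP.Network.exists_absDeadlocked hV hs hdead
  choose! f hf using fun i (hi : i ∈ M.participants) => hstruct.exists_starves hV hbehav hY hi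
  have hf_mem : ∀ i ∈ M.participants, f i ∈ M.participants := fun i hi =>
    ⟨i, .inl (hf i hi).mem_onPeers.1⟩
  obtain ⟨i, hi, hmin⟩ := Set.exists_min_image M.participants
    (fun i => M.lastTime .receiving (f i) i s) (Set.toFinite _) (hstruct.participants_nonempty hn)
  exact (hmin (f i) (hf_mem i hi)).not_gt
    ((hf i hi).lastTime_receiving_lt (hf (f i) (hf_mem i hi)))
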